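/- Let $r\ge 2$ and $k\ge 1$. Let $\mathcal P_{r,k}$ be the set of permutations $\pi\in\mathfrak S_{rk+1}$ such that $\tau=\pi^{-1}$ is a $2134\cdots(r+1)$-cluster, that is, for every $0\le j\le k-1$ the $r+1$ consecutive letters $\tau_{rj+1}\tau_{rj+2}\cdots\tau_{rj+r+1}$ are in the same relative order as $2\,1\,3\,4\cdots(r+1)$. For $\pi=\pi_1\cdots\pi_n\in\mathfrak S_n$ let $\operatorname{des}(\pi)$ be the number of $i\in\{1,\dots,n-1\}$ with $\pi_i>\pi_{i+1}$ (descents), let $\operatorname{pk}(\pi)$ be the number of $i\in\{2,\dots,n-1\}$ with $\pi_{i-1}<\pi_i>\pi_{i+1}$ (peaks), and let $\operatorname{lpk}(\pi)$ be the number of left peaks, i.e. of those $i$ that are peaks or satisfy $i=1$ and $\pi_1>\pi_2$. For $\operatorname{st}\in\{\operatorname{des},\operatorname{pk},\operatorname{lpk}\}$ put $C^{\operatorname{st}}_{r,k}(t)=\sum_{\pi\in\mathcal P_{r,k}}t^{\operatorname{st}(\pi)}$ and let $X^{\operatorname{st}}_{r,k}$ be the random variable with $\mathbb P(X^{\operatorname{st}}_{r,k}=j)=[t^j]C^{\operatorname{st}}_{r,k}(t)/C^{\operatorname{st}}_{r,k}(1)$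 for all $j\ge0$ (this is a probability distribution, namely that of $\operatorname{st}$ over $\mathcal P_{r,k}$). Let \[ c_{r,k}=\frac{r\sin(\pi/r)\,\Gamma(1+1/r)^2\,\Gamma(k-1/r)}{\pi\,(r+2)\,\Gamma(k+1/r)} . \] Then, for all $r\ge2$ and $k\ge1$, \[ \mathbb E(X^{\operatorname{des}}_{r,k})=\frac{rk+1}{r+1},\qquad \mathbb E(X^{\operatorname{pk}}_{r,k})=\frac{(2k-1)r}{2(r+2)}-\frac r2\,c_{r,k},\qquad \mathbb E(X^{\operatorname{lpk}}_{r,k})=\frac{rk+1}{r+2}+c_{r,k}, \] and, for every fixed $r\ge2$, as $k\to\infty$, \[ \mathbb E(X^{\operatorname{des}}_{r,k})\sim\frac{rk}{r+1},\qquad \mathbb E(X^{\operatorname{pk}}_{r,k})\sim\frac{rk}{r+2},\qquad \mathbb E(X^{\operatorname{lpk}}_{r,k})\sim\frac{rk}{r+2}, \] \[ \mathbb V(X^{\operatorname{des}}_{r,k})\sim\frac{r^2k}{(r+1)^2(r+2)},\qquad \mathbb V(X^{\operatorname{pk}}_{r,k})\sim\frac{2r^2k}{(r+2)^2(r+4)},\qquad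 \mathbb V(X^{\operatorname{lpk}}_{r,k})\sim\frac{2r^2k}{(r+2)^2(r+4)} . \] -/

import Mathlib

/-!
Positions are indexed from `0`: the position `i` of the one-line notation `π_1 ⋯ π_n` is the
element `i - 1` of `Fin n`. Letters keep their usual names `1, …, n`.
-/

namespace StirlingClusters

/-- The letters `π_1, …, π_n` of the one-line notation of `π ∈ 𝔖_n`. -/
def letter {n : ℕ} (π : Equiv.Perm (Fin n)) (i : Fin n) : ℕ := (π i : ℕ) + 1

/-- Standardization of a word with distinct letters: the smallest letter is replaced by `1`,
the second smallest by `2`, and so on. -/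
def std {m : ℕ} (w : Fin m → ℕ) (i : Fin m) : ℕ :=
  (Finset.univ.filter fun j : Fin m => w j < w i).card + 1

/-- The pattern `2134⋯m`. -/
def pattern (m : ℕ) (i : Fin m) : ℕ :=
  if (i : ℕ) = 0 then 2 else if (i : ℕ) = 1 then 1 else (i : ℕ) + 1

/-- The `m` consecutive letters of `π` starting at position `i` (counted from `0`) form an
occurrence of the consecutive pattern `σ`. -/
def OccursAt {m n : ℕ} (σ : Fin m → ℕ) (π : Equiv.Perm (Fin n)) (i : ℕ) : Prop :=
  ∃ h : i + m ≤ n, std (fun j : Fin m => letter π ⟨i + j, by omega⟩) = σ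

/-- `π` is a `2134⋯m`-cluster with `k` marked occurrences: it has length `(m - 1) k + 1`, and the
pattern occurs at each of the positions `(m - 1) j + 1`, `0 ≤ j ≤ k - 1`. -/
def IsCluster (m k : ℕ) {n : ℕ} (π : Equiv.Perm (Fin n)) : Prop :=
  n = (m - 1) * k + 1 ∧ ∀ j < k, OccursAt (pattern m) π ((m - 1) * j)

open Classical in
/-- `𝒫_{r,k}`, the set of inverses of `2134⋯(r+1)`-clusters in `𝔖_{rk+1}`. -/
noncomputable def P (r k : ℕ) : Finset (Equiv.Perm (Fin (r * k + 1))) :=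
  Finset.univ.filter fun π => IsCluster (r + 1) k π⁻¹

/-- `π_i > π_{i+1}`. -/
def IsDescent {n : ℕ} (π : Equiv.Perm (Fin n)) (i : Fin n) : Prop :=
  ∃ h : (i : ℕ) + 1 < n, letter π ⟨i + 1, h⟩ < letter π i

/-- `π_{i-1} < π_i > π_{i+1}`. -/
def IsPeak {n : ℕ} (π : Equiv.Perm (Fin n)) (i : Fin n) : Prop :=
  ∃ (_ : 1 ≤ (i : ℕ)) (h : (i : ℕ) + 1 < n),
    letter π ⟨i - 1, by omega⟩ < letter π i ∧ letter π ⟨i + 1, h⟩ < letter π i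

/-- A peak, or a descent at the first position. -/
def IsLeftPeak {n : ℕ} (π : Equiv.Perm (Fin n)) (i : Fin n) : Prop :=
  IsPeak π i ∨ ((i : ℕ) = 0 ∧ IsDescent π i)

open Classical in
/-- The descent number. -/
noncomputable def des {n : ℕ} (π : Equiv.Perm (Fin n)) : ℕ :=
  (Finset.univ.filter fun i => IsDescent π i).card

open Classical in
/-- The peak number. -/
noncomputable def pk {n : ℕ} (π : Equiv.Perm (Fin n)) : ℕ :=
  (Finset.univ.filter fun i => IsPeak π i).card

open Classical in
/-- The left peak number. -/
noncomputable def lpk {n : ℕ} (π : Equiv.Perm (Fin n)) : ℕ :=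
  (Finset.univ.filter fun i => IsLeftPeak π i).card

/-- `C_{r,k}^{des}(t)`. -/
noncomputable def Cdes (r k : ℕ) : Polynomial ℝ := ∑ π ∈ P r k, Polynomial.X ^ des π

/-- `C_{r,k}^{pk}(t)`. -/
noncomputable def Cpk (r k : ℕ) : Polynomial ℝ := ∑ π ∈ P r k, Polynomial.X ^ pk π

/-- `C_{r,k}^{lpk}(t)`. -/
noncomputable def Clpk (r k : ℕ) : Polynomial ℝ := ∑ π ∈ P r k, Polynomial.X ^ lpk π

/-- The law, on `ℝ`, of the random variable `X` induced by a polynomial `f` with non-negative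
coefficients: `ℙ(X = j) = [t^j] f(t) / f(1)`. -/
noncomputable def law (f : Polynomial ℝ) : MeasureTheory.Measure ℝ :=
  ∑ j ∈ f.support, ENNReal.ofReal (f.coeff j / f.eval 1) • MeasureTheory.Measure.dirac (j : ℝ)

/-- The mean of the random variable induced by `f`. -/
noncomputable def mean (f : Polynomial ℝ) : ℝ := ∫ x, x ∂(law f)

/-- The variance of the random variable induced by `f`. -/
noncomputable def variance (f : Polynomial ℝ) : ℝ :=
  ProbabilityTheory.variance (fun x : ℝ => x) (law f)

/-- The constant `c_{r,k}`. -/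
noncomputable def c (r k : ℕ) : ℝ :=
  (r * Real.sin (Real.pi / r) * Real.Gamma (1 + 1 / r) ^ 2 * Real.Gamma (k - 1 / r)) /
    (Real.pi * (r + 2) * Real.Gamma (k + 1 / r))

end StirlingClusters

/-!
Inverting turns the marked cluster into a growth process. If `τ` is a `2134⋯(r+1)`-cluster with
`k + 1` blocks, then the letters at the block boundaries are increasing, so that in the last block
only the second letter is free: it takes any value below the first letter of the block, and all
letters after it are the largest ones, in increasing order. Read in `π = τ⁻¹`, this says that every
`π ∈ 𝒫_{r,k+1}` arises exactly once from an element of `𝒫_{r,k}`, a word of length `n = r k + 1`, by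
inserting a new maximum into one of the `n` gaps before its last letter (`insertCycle`) and then
appending larger letters in increasing order (`sum_natP_succ`). Permutations are extended to `ℕ` by
fixed points, so that the appended letters need no separate treatment.

Such an insertion keeps each of the three statistics or raises it by one, and the number of gaps
that keep it depends on the statistic alone: with value `x` it is `a x + b`, where `(a, b)` is
`(1, 0)` for `des` (the descents), `(2, 0)` for `lpk` (the two gaps next to a left peak) and
`(2, 1)` for `pk` (the two gaps next to a peak, and the front). This is `GrowsByInsertion`. Hence
the mean `m` and the variance `V` satisfy
`m' = (1 - a / n) m + (1 - b / n)` and `V' = (1 - 2 a / n) V + u (1 - u)`, where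
`u = 1 - (a m + b) / n` is the probability of growth (`GrowsByInsertion.mean_succ`,
`GrowsByInsertion.variance_succ`).

The explicit means solve the first recurrence: by `Γ (x + 1) = x Γ x`, the constant `c r k` is
multiplied by `1 - 2 / n` in each step, and the reflection formula gives its initial value
`1 / (r + 2)` (`c_succ`, `c_one`). Both recurrences are of the form `y' = (1 - A / n) y + s` with
`s → l`, which forces `y / k → l r / (r + A)` by a Cesàro argument (`tendsto_div_of_recurrence`);
`l = 1` for the mean, and `l = r a / (r + a)²` for the variance.
-/

namespace StirlingClusters

open Filter Topology Polynomial

/-! ### Moments of the law of a generating polynomial -/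

section Law

variable {ι : Type*} (s : Finset ι) (st : ι → ℕ)

theorem sum_coeff_mul_sum_X_pow (g : ℕ → ℝ) :
    ∑ j ∈ (∑ i ∈ s, (X : ℝ[X]) ^ st i).support, (∑ i ∈ s, (X : ℝ[X]) ^ st i).coeff j * g j =
      ∑ i ∈ s, g (st i) := by
  classical
  change (∑ i ∈ s, (X : ℝ[X]) ^ st i).sum (fun j a => a * g j) = _
  induction s using Finset.induction_on with
  | empty => simp
  | insert a s ha ih =>
    rw [Finset.sum_insert ha, Finset.sum_insert ha, Polynomial.sum_add_index, ih]
    · rw [← Polynomial.monomial_one_right_eq_X_pow, Polynomial.sum_monomial_index] <;> simp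
    · simp
    · intros; ring

theorem eval_one_sum_X_pow : (∑ i ∈ s, (X : ℝ[X]) ^ st i).eval 1 = s.card := by
  simp [Polynomial.eval_finsetSum]

theorem coeff_sum_X_pow_nonneg (j : ℕ) : 0 ≤ (∑ i ∈ s, (X : ℝ[X]) ^ st i).coeff j := by
  rw [Polynomial.finsetSum_coeff]
  exact Finset.sum_nonneg fun i _ => by rw [Polynomial.coeff_X_pow]; split_ifs <;> simp

theorem isProbabilityMeasure_law (hs : s.Nonempty) :
    MeasureTheory.IsProbabilityMeasure (law (∑ i ∈ s, (X : ℝ[X]) ^ st i)) := by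
  constructor
  have hc : (s.card : ℝ) ≠ 0 := by exact_mod_cast hs.card_pos.ne'
  simp only [law, MeasureTheory.Measure.coe_finsetSum, Finset.sum_apply,
    MeasureTheory.Measure.smul_apply, MeasureTheory.measure_univ, smul_eq_mul, mul_one]
  rw [eval_one_sum_X_pow, ← ENNReal.ofReal_sum_of_nonneg
    (fun j _ => div_nonneg (coeff_sum_X_pow_nonneg s st j) (Nat.cast_nonneg _)), ← Finset.sum_div]
  have := sum_coeff_mul_sum_X_pow s st (fun _ => 1)
  simp only [mul_one] at this
  rw [this]
  simp [hc]

theorem integral_law (g : ℝ → ℝ) :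
    ∫ x, g x ∂(law (∑ i ∈ s, (X : ℝ[X]) ^ st i)) = (∑ i ∈ s, g (st i)) / s.card := by
  rw [law, MeasureTheory.integral_finsetSum_measure]
  · simp only [MeasureTheory.integral_smul_measure, MeasureTheory.integral_dirac, smul_eq_mul]
    rw [← sum_coeff_mul_sum_X_pow s st (fun j => g j), Finset.sum_div]
    refine Finset.sum_congr rfl fun j _ => ?_
    rw [eval_one_sum_X_pow, ENNReal.toReal_ofReal
      (div_nonneg (coeff_sum_X_pow_nonneg s st j) (Nat.cast_nonneg _))]
    ring
  · intro j _
    exact (MeasureTheory.integrable_dirac (by simp)).smul_measure ENNReal.ofReal_ne_top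

theorem mean_sum_X_pow :
    mean (∑ i ∈ s, (X : ℝ[X]) ^ st i) = (∑ i ∈ s, (st i : ℝ)) / s.card :=
  integral_law s st fun x => x

theorem variance_sum_X_pow (hs : s.Nonempty) :
    variance (∑ i ∈ s, (X : ℝ[X]) ^ st i) =
      (∑ i ∈ s, (st i : ℝ) ^ 2) / s.card - mean (∑ i ∈ s, (X : ℝ[X]) ^ st i) ^ 2 := by
  have hc : (s.card : ℝ) ≠ 0 := by exact_mod_cast hs.card_pos.ne'
  rw [variance, ProbabilityTheory.variance_eq_integral (X := fun x : ℝ => x)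
    measurable_id.aemeasurable]
  change ∫ x, (x - mean (∑ i ∈ s, (X : ℝ[X]) ^ st i)) ^ 2 ∂_ = _
  rw [integral_law s st (fun x => (x - mean (∑ i ∈ s, (X : ℝ[X]) ^ st i)) ^ 2)]
  have hm := mean_sum_X_pow s st
  set m := mean (∑ i ∈ s, (X : ℝ[X]) ^ st i)
  have h1 : ∑ i ∈ s, (st i : ℝ) = m * s.card := by rw [hm]; field_simp
  simp only [sub_sq, Finset.sum_add_distrib, Finset.sum_sub_distrib, ← Finset.sum_mul,
    ← Finset.mul_sum, h1, Finset.sum_const, nsmul_eq_mul]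
  field_simp
  ring

end Law

/-! ### Linear recurrences with a coefficient `1 - A / (r k + 1)` -/

/-- If `e` contracts up to an error that tends to `0`, then `e k = o(k)`. -/
theorem tendsto_div_of_abs_le_add {e ε : ℕ → ℝ} (hε : Tendsto ε atTop (𝓝 0))
    (h : ∀ᶠ k in atTop, |e (k + 1)| ≤ |e k| + ε k) :
    Tendsto (fun k : ℕ => e k / k) atTop (𝓝 0) := by
  obtain ⟨K, hK⟩ := eventually_atTop.1 h
  have hb : ∀ k, |e (k + K)| ≤ |e K| + ∑ i ∈ Finset.range k, ε (i + K) := by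
    intro k
    induction k with
    | zero => simp
    | succ k ih =>
      rw [Finset.sum_range_succ, show k + 1 + K = k + K + 1 by ring]
      have := hK (k + K) (by omega)
      linarith
  have hC := ((tendsto_add_atTop_iff_nat K).2 hε).cesaro
  have hE : Tendsto (fun k : ℕ => (k : ℝ)⁻¹ * |e K|) atTop (𝓝 0) := by
    simpa using (tendsto_inv_atTop_nhds_zero_nat (𝕜 := ℝ)).mul_const |e K|
  have hS := hE.add hC
  rw [add_zero] at hS
  rw [← tendsto_add_atTop_iff_nat K]
  refine squeeze_zero_norm' ?_ hS
  filter_upwards [eventually_gt_atTop 0] with k hk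
  have hk' : (0 : ℝ) < k := by exact_mod_cast hk
  rw [Real.norm_eq_abs, abs_div, abs_of_nonneg (by positivity : (0 : ℝ) ≤ ((k + K : ℕ) : ℝ)),
    ← mul_add, inv_mul_eq_div]
  calc |e (k + K)| / ((k + K : ℕ) : ℝ) ≤ |e (k + K)| / k := by
        gcongr; omega
    _ ≤ _ := by gcongr; exact hb k

theorem tendsto_natCast_div_mul_natCast_add_one {r : ℕ} (hr : 0 < r) :
    Tendsto (fun k : ℕ => (k : ℝ) / ((r : ℝ) * k + 1)) atTop (𝓝 (1 / r)) := by
  have hr' : (r : ℝ) ≠ 0 := by positivity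
  have h : Tendsto (fun k : ℕ => 1 / ((r : ℝ) + (k : ℝ)⁻¹)) atTop (𝓝 (1 / ((r : ℝ) + 0))) :=
    tendsto_const_nhds.div (tendsto_inv_atTop_nhds_zero_nat.const_add _) (by simpa using hr.ne')
  rw [add_zero] at h
  refine h.congr' ?_
  filter_upwards [eventually_gt_atTop 0] with k hk
  have hk' : (k : ℝ) ≠ 0 := by positivity
  field_simp

/-- With `v = l r / (r + A)`, the difference `y k - v k` satisfies the same recurrence with an
inhomogeneity that tends to `0`. -/
theorem tendsto_div_of_recurrence {r : ℕ} (hr : 0 < r) {A l : ℝ} (hA : 0 ≤ A) {y s : ℕ → ℝ}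
    (hs : Tendsto s atTop (𝓝 l))
    (hy : ∀ k : ℕ, y (k + 1) = (1 - A / ((r : ℝ) * k + 1)) * y k + s k) :
    Tendsto (fun k : ℕ => y k / k) atTop (𝓝 (l * r / (r + A))) := by
  have hr' : (0 : ℝ) < r := by positivity
  have hrA : (r : ℝ) + A ≠ 0 := by positivity
  set v := l * r / (r + A) with hv
  have hε : Tendsto (fun k : ℕ => s k - v - A * v * ((k : ℝ) / ((r : ℝ) * k + 1))) atTop (𝓝 0) := by
    have := (hs.sub_const v).sub ((tendsto_natCast_div_mul_natCast_add_one hr).const_mul (A * v))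
    convert this using 2
    rw [hv]; field_simp; ring
  -- the coefficient `1 - A / (r k + 1)` lies in `[0, 1]` only for large `k`
  have hbig : ∀ᶠ k : ℕ in atTop, A ≤ (r : ℝ) * k + 1 := by
    filter_upwards [(tendsto_natCast_atTop_atTop (R := ℝ)).eventually_ge_atTop (A / r)] with k hk
    rw [div_le_iff₀ hr'] at hk
    linarith
  have key := tendsto_div_of_abs_le_add (e := fun k => y k - v * k) (abs_zero (α := ℝ) ▸ hε.abs) (by
    filter_upwards [hbig] with k hk
    have hn : (0 : ℝ) < (r : ℝ) * k + 1 := by positivity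
    have h1 : y (k + 1) - v * ((k + 1 : ℕ) : ℝ) = (1 - A / ((r : ℝ) * k + 1)) * (y k - v * k) +
        (s k - v - A * v * ((k : ℝ) / ((r : ℝ) * k + 1))) := by
      rw [hy]; push_cast; ring
    rw [h1]
    refine (abs_add_le _ _).trans (add_le_add_left ?_ _)
    rw [abs_mul]
    have h0 : 0 ≤ A / ((r : ℝ) * k + 1) := by positivity
    have h2 : A / ((r : ℝ) * k + 1) ≤ 1 := (div_le_one hn).2 hk
    exact mul_le_of_le_one_left (abs_nonneg _) (abs_le.2 ⟨by linarith, by linarith⟩))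
  have := key.add_const v
  rw [zero_add] at this
  refine this.congr' ?_
  filter_upwards [eventually_gt_atTop 0] with k hk
  have hk' : (k : ℝ) ≠ 0 := by positivity
  field_simp
  ring

theorem isEquivalent_of_tendsto_div {y w : ℕ → ℝ} {v : ℝ} (hv : v ≠ 0)
    (h : Tendsto (fun k : ℕ => y k / k) atTop (𝓝 v)) (hw : ∀ k : ℕ, w k = v * k) :
    Asymptotics.IsEquivalent atTop y w := by
  refine Asymptotics.isEquivalent_of_tendsto_one ?_
  have := h.div_const v
  rw [div_self hv] at this
  refine this.congr fun k => ?_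
  rw [Pi.div_apply, hw, div_div, mul_comm (k : ℝ)]

/-! ### Moments under insertion -/

section Growth

variable {ι : ℕ → Type*} {s : ∀ k, Finset (ι k)} {st : ∀ k, ι k → ℕ} {r : ℕ} {a b : ℝ}

/-- The statistic `st` on the sets `s k` evolves by insertion: every object of `s k` has
`r k + 1` descendants in `s (k + 1)`; the statistic is unchanged in `a * st + b` of them, and grows
by `1` in the others. -/
def GrowsByInsertion (s : ∀ k, Finset (ι k)) (st : ∀ k, ι k → ℕ) (r : ℕ) (a b : ℝ) : Prop :=
  ∀ (F : ℕ → ℝ) (k : ℕ), ∑ x ∈ s (k + 1), F (st (k + 1) x) =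
    ∑ x ∈ s k, ((a * st k x + b) * F (st k x) +
      ((r : ℝ) * k + 1 - (a * st k x + b)) * F (st k x + 1))

theorem GrowsByInsertion.card_succ (h : GrowsByInsertion s st r a b) (k : ℕ) :
    ((s (k + 1)).card : ℝ) = ((r : ℝ) * k + 1) * (s k).card := by
  have := h (fun _ => 1) k
  simp only [Finset.sum_const, nsmul_eq_mul, mul_one, add_sub_cancel] at this
  rw [this]; ring

theorem GrowsByInsertion.nonempty (h : GrowsByInsertion s st r a b) (h0 : (s 0).Nonempty)
    (k : ℕ) : (s k).Nonempty := by
  induction k with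
  | zero => exact h0
  | succ k ih =>
    have h1 : (0 : ℝ) < (s k).card := by exact_mod_cast ih.card_pos
    have h2 : (0 : ℝ) < (s (k + 1)).card := by rw [h.card_succ]; positivity
    exact Finset.card_pos.1 (by exact_mod_cast h2)

theorem GrowsByInsertion.mean_succ (h : GrowsByInsertion s st r a b) (h0 : (s 0).Nonempty)
    (k : ℕ) :
    mean (∑ x ∈ s (k + 1), (X : ℝ[X]) ^ st (k + 1) x) =
      (1 - a / ((r : ℝ) * k + 1)) * mean (∑ x ∈ s k, (X : ℝ[X]) ^ st k x) +
        (1 - b / ((r : ℝ) * k + 1)) := by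
  have hc : ((s k).card : ℝ) ≠ 0 := by exact_mod_cast (h.nonempty h0 k).card_pos.ne'
  have hn : (r : ℝ) * k + 1 ≠ 0 := by positivity
  rw [mean_sum_X_pow, mean_sum_X_pow, h.card_succ, h (fun j => (j : ℝ))]
  have : ∀ x, ((a * st k x + b) * (st k x : ℝ) +
      ((r : ℝ) * k + 1 - (a * st k x + b)) * ((st k x + 1 : ℕ) : ℝ)) =
      ((r : ℝ) * k + 1 - a) * st k x + ((r : ℝ) * k + 1 - b) := by
    intro x; push_cast; ring
  simp only [this, Finset.sum_add_distrib, ← Finset.mul_sum, Finset.sum_const, nsmul_eq_mul]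
  field_simp

/-- The law of total variance for one insertion step: `u` is the probability that the statistic
grows. -/
theorem GrowsByInsertion.variance_succ (h : GrowsByInsertion s st r a b) (h0 : (s 0).Nonempty)
    (k : ℕ) {u : ℝ}
    (hu : u = 1 - (a * mean (∑ x ∈ s k, (X : ℝ[X]) ^ st k x) + b) / ((r : ℝ) * k + 1)) :
    variance (∑ x ∈ s (k + 1), (X : ℝ[X]) ^ st (k + 1) x) =
      (1 - 2 * a / ((r : ℝ) * k + 1)) * variance (∑ x ∈ s k, (X : ℝ[X]) ^ st k x) +
        u * (1 - u) := by
  have hc : ((s k).card : ℝ) ≠ 0 := by exact_mod_cast (h.nonempty h0 k).card_pos.ne'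
  have hn : (r : ℝ) * k + 1 ≠ 0 := by positivity
  rw [variance_sum_X_pow _ _ (h.nonempty h0 _), variance_sum_X_pow _ _ (h.nonempty h0 _),
    h.mean_succ h0, h.card_succ, h (fun j => (j : ℝ) ^ 2)]
  have hm := mean_sum_X_pow (s k) (st k)
  set m := mean (∑ x ∈ s k, (X : ℝ[X]) ^ st k x)
  have h1 : ∑ x ∈ s k, (st k x : ℝ) = m * (s k).card := by rw [hm]; field_simp
  have : ∀ x, ((a * st k x + b) * (st k x : ℝ) ^ 2 +
      ((r : ℝ) * k + 1 - (a * st k x + b)) * ((st k x + 1 : ℕ) : ℝ) ^ 2) =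
      ((r : ℝ) * k + 1 - 2 * a) * (st k x : ℝ) ^ 2 +
        (2 * ((r : ℝ) * k + 1) - a - 2 * b) * st k x + ((r : ℝ) * k + 1 - b) := by
    intro x; push_cast; ring
  simp only [this, Finset.sum_add_distrib, ← Finset.mul_sum, Finset.sum_const, nsmul_eq_mul, h1]
  rw [hu]
  field_simp
  ring

theorem tendsto_const_div_mul_natCast_add_one {r : ℕ} (hr : 0 < r) (b : ℝ) :
    Tendsto (fun k : ℕ => b / ((r : ℝ) * k + 1)) atTop (𝓝 0) := by
  have hr' : (0 : ℝ) < r := by positivity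
  exact tendsto_const_nhds.div_atTop (tendsto_atTop_add_const_right _ _
    ((tendsto_natCast_atTop_atTop (R := ℝ)).const_mul_atTop hr'))

theorem GrowsByInsertion.tendsto_mean_div (h : GrowsByInsertion s st r a b)
    (h0 : (s 0).Nonempty) (hr : 0 < r) (ha : 0 ≤ a) :
    Tendsto (fun k : ℕ => mean (∑ x ∈ s k, (X : ℝ[X]) ^ st k x) / k) atTop
      (𝓝 ((r : ℝ) / (r + a))) := by
  have hs : Tendsto (fun k : ℕ => 1 - b / ((r : ℝ) * k + 1)) atTop (𝓝 1) := by
    simpa using (tendsto_const_div_mul_natCast_add_one hr b).const_sub 1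
  simpa using tendsto_div_of_recurrence hr ha hs (h.mean_succ h0)

theorem GrowsByInsertion.tendsto_variance_div (h : GrowsByInsertion s st r a b)
    (h0 : (s 0).Nonempty) (hr : 0 < r) (ha : 0 ≤ a) :
    Tendsto (fun k : ℕ => variance (∑ x ∈ s k, (X : ℝ[X]) ^ st k x) / k) atTop
      (𝓝 (a * (r : ℝ) ^ 2 / ((r + a) ^ 2 * (r + 2 * a)))) := by
  have hr' : (0 : ℝ) < r := by positivity
  have hra : (r : ℝ) + a ≠ 0 := by positivity
  have hra' : (r : ℝ) + 2 * a ≠ 0 := by positivity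
  set u : ℕ → ℝ := fun k =>
    1 - (a * mean (∑ x ∈ s k, (X : ℝ[X]) ^ st k x) + b) / ((r : ℝ) * k + 1) with hu
  have hul : Tendsto u atTop (𝓝 (r / (r + a))) := by
    have h1 := (((h.tendsto_mean_div h0 hr ha).mul
      (tendsto_natCast_div_mul_natCast_add_one hr)).const_mul a).add
      (tendsto_const_div_mul_natCast_add_one hr b)
    have h2 := h1.const_sub 1
    refine (h2.congr' ?_).trans (le_of_eq ?_)
    · filter_upwards [eventually_gt_atTop 0] with k hk
      have hk' : (k : ℝ) ≠ 0 := by positivity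
      have hn : (r : ℝ) * k + 1 ≠ 0 := by positivity
      simp only [hu]
      field_simp
    · congr 1; field_simp; ring
  have := tendsto_div_of_recurrence hr (by positivity : (0 : ℝ) ≤ 2 * a)
    (y := fun k => variance (∑ x ∈ s k, (X : ℝ[X]) ^ st k x))
    (hul.mul (hul.const_sub 1)) (fun k => h.variance_succ h0 k (u := u k) rfl)
  refine this.trans (le_of_eq ?_)
  congr 1; field_simp; ring

end Growth

end StirlingClusters

namespace StirlingClusters

open Equiv

/-! ### Insertion of a new maximum -/

/-- The permutation `σ * insertCycle n p` is obtained from a permutation `σ` of `ℕ` that fixes `n`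
by moving the letter `n` to position `p ≤ n`. For `n < p` this is the identity. -/
def insertCycle (n p : ℕ) : Perm ℕ where
  toFun i := if n < i ∨ i < p then i else if i = p then n else i - 1
  invFun i := if n < i ∨ i < p then i else if i = n then p else i + 1
  left_inv i := by dsimp only; split_ifs <;> omega
  right_inv i := by dsimp only; split_ifs <;> omega

theorem insertCycle_apply (n p i : ℕ) :
    insertCycle n p i = if n < i ∨ i < p then i else if i = p then n else i - 1 := rfl

theorem insertCycle_inv_apply (n p i : ℕ) :
    (insertCycle n p)⁻¹ i = if n < i ∨ i < p then i else if i = n then p else i + 1 := rfl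

theorem insertCycle_inv_lt_iff {n p i j : ℕ} (hi : i ≠ n) (hj : j ≠ n) :
    (insertCycle n p)⁻¹ i < (insertCycle n p)⁻¹ j ↔ i < j := by
  simp only [insertCycle_inv_apply]
  split_ifs <;> omega

/-- The positions of the inserted word that come from `S`, together with `p` itself. -/
def insertPositions (p : ℕ) (S : Finset ℕ) : Finset ℕ :=
  insert p (S.image fun i => if i < p then i else i + 1)

theorem mem_image_shift {p i : ℕ} {S : Finset ℕ} :
    i ∈ S.image (fun i => if i < p then i else i + 1) ↔
      (i < p ∧ i ∈ S) ∨ (p < i ∧ i - 1 ∈ S) := by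
  simp only [Finset.mem_image]
  constructor
  · rintro ⟨j, hj, rfl⟩
    split_ifs with h
    · exact Or.inl ⟨h, hj⟩
    · exact Or.inr ⟨by omega, by simpa using hj⟩
  · rintro (⟨h, hi⟩ | ⟨h, hi⟩)
    · exact ⟨i, hi, by simp [h]⟩
    · exact ⟨i - 1, hi, by rw [if_neg (by omega)]; omega⟩

theorem card_image_shift (p : ℕ) (S : Finset ℕ) :
    (S.image fun i => if i < p then i else i + 1).card = S.card :=
  Finset.card_image_of_injective _ fun i j h => by
    by_cases hi : i < p <;> by_cases hj : j < p <;> simp [hi, hj] at h <;> omega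

theorem card_insertPositions (p : ℕ) (S : Finset ℕ) :
    (insertPositions p S).card = S.card + 1 := by
  rw [insertPositions, Finset.card_insert_of_notMem, card_image_shift]
  rw [mem_image_shift]; omega

theorem mem_insertPositions {p i : ℕ} {S : Finset ℕ} :
    i ∈ insertPositions p S ↔ i = p ∨ (i < p ∧ i ∈ S) ∨ (p < i ∧ i - 1 ∈ S) := by
  rw [insertPositions, Finset.mem_insert, mem_image_shift]

/-- The descent positions of `w` below `N`. -/
def desSet (w : ℕ → ℕ) (N : ℕ) : Finset ℕ := {i ∈ Finset.range N | w (i + 1) < w i}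

/-- The left peak positions of `w` below `N`. -/
def lpkSet (w : ℕ → ℕ) (N : ℕ) : Finset ℕ :=
  {i ∈ Finset.range N | (i = 0 ∨ w (i - 1) < w i) ∧ w (i + 1) < w i}

/-- The peak positions of `w` below `N`. -/
def pkSet (w : ℕ → ℕ) (N : ℕ) : Finset ℕ :=
  {i ∈ Finset.range N | i ≠ 0 ∧ w (i - 1) < w i ∧ w (i + 1) < w i}

theorem pkSet_eq_erase (w : ℕ → ℕ) (N : ℕ) : pkSet w N = (lpkSet w N).erase 0 := by
  ext i
  simp only [pkSet, lpkSet, Finset.mem_filter, Finset.mem_erase]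
  tauto

/-- Here `B` is the set of the gaps whose insertion leaves the statistic `st` unchanged. -/
theorem sum_range_eq_of_eq_ite {n st : ℕ} {st' : ℕ → ℕ} {B : Finset ℕ} (hB : B ⊆ Finset.range n)
    (h : ∀ p < n, st' p = if p ∈ B then st else st + 1) (F : ℕ → ℝ) :
    ∑ p ∈ Finset.range n, F (st' p) = B.card * F st + (n - B.card) * F (st + 1) := by
  rw [← Finset.sum_sdiff hB, Finset.sum_congr rfl (g := fun _ => F (st + 1)),
    Finset.sum_congr (s₁ := B) rfl (g := fun _ => F st)]
  · rw [Finset.sum_const, Finset.sum_const, nsmul_eq_mul, nsmul_eq_mul,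
      Finset.card_sdiff_of_subset hB, Nat.cast_sub (Finset.card_le_card hB), Finset.card_range]
    ring
  · intro p hp
    rw [h p (Finset.mem_range.1 (hB hp)), if_pos hp]
  · intro p hp
    rw [Finset.mem_sdiff, Finset.mem_range] at hp
    rw [h p hp.1, if_neg hp.2]

theorem apply_lt_of_fix {w : Perm ℕ} {n : ℕ} (hfix : ∀ i, n ≤ i → w i = i) {i : ℕ}
    (hi : i < n) : w i < n := by
  by_contra! h
  have := w.injective (hfix _ h)
  omega

theorem desSet_subset {w : Perm ℕ} {n : ℕ} (hfix : ∀ i, n ≤ i → w i = i) :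
    desSet w n ⊆ Finset.range (n - 1) := by
  intro i hi
  simp only [desSet, Finset.mem_filter, Finset.mem_range] at hi ⊢
  by_contra h
  have h1 := apply_lt_of_fix hfix hi.1
  rw [hfix (i + 1) (by omega)] at hi
  omega

theorem lpkSet_subset_desSet (w : ℕ → ℕ) (n : ℕ) : lpkSet w n ⊆ desSet w n := by
  intro i hi
  simp only [desSet, lpkSet, Finset.mem_filter] at hi ⊢
  exact ⟨hi.1, hi.2.2⟩

theorem lpkSet_succ_notMem {w : ℕ → ℕ} {n i : ℕ} (hi : i ∈ lpkSet w n) :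
    i + 1 ∉ lpkSet w n := by
  simp only [lpkSet, Finset.mem_filter, Nat.add_sub_cancel] at hi ⊢
  omega

section Insert

variable {w : Perm ℕ} {n p N : ℕ}

theorem mul_insertCycle_apply (hfix : ∀ i, n ≤ i → w i = i) (i : ℕ) :
    (w * insertCycle n p) i =
      if n < i then i else if i < p then w i else if i = p then n else w (i - 1) := by
  rw [Perm.mul_apply, insertCycle_apply]
  by_cases h1 : n < i
  · simp [h1, hfix i h1.le]
  · simp only [h1, false_or, if_false]
    split_ifs with h2 h3 <;> simp [hfix n le_rfl]

/-- Inserting a new maximum at `p` creates a descent at `p`, and destroys a descent of the two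
letters between which it is inserted. -/
theorem desSet_insertCycle (hfix : ∀ i, n ≤ i → w i = i) (hp : p < n) (hN : n < N) :
    desSet (w * insertCycle n p : Perm ℕ) N =
      insertPositions p {i ∈ desSet w n | i + 1 ≠ p} := by
  ext i
  simp only [mem_insertPositions, desSet, Finset.mem_filter, Finset.mem_range,
    mul_insertCycle_apply hfix]
  have h0 := fun i => apply_lt_of_fix hfix (i := i)
  rcases lt_trichotomy i p with h | rfl | h
  · have := h0 i (by omega)
    simp only [show ¬ n < i by omega, show ¬ n < i + 1 by omega, h, if_true, if_false, true_and]
    split_ifs <;> grind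
  · have := h0 i (by omega)
    simp [show ¬ n < i by omega, show ¬ n < i + 1 by omega]
    grind
  · by_cases h1 : n < i
    · simp [h1, show n < i + 1 by omega]
      grind
    · have := h0 (i - 1) (by omega)
      simp only [h1, show ¬ i < p by omega, show ¬ i + 1 < p by omega, show i ≠ p by omega,
        show i + 1 ≠ p by omega, if_false, Nat.add_sub_cancel, show i - 1 + 1 = i by omega]
      by_cases h2 : n < i + 1
      · have := hfix i (by omega)
        simp only [h2, if_true]
        grind
      · simp only [h2, if_false]
        grind

/-- Inserting a new maximum at `p` creates a left peak at `p`, and destroys a left peak at either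
of the two letters between which it is inserted. -/
theorem lpkSet_insertCycle (hfix : ∀ i, n ≤ i → w i = i) (hp : p < n) (hN : n < N) :
    lpkSet (w * insertCycle n p : Perm ℕ) N =
      insertPositions p {i ∈ lpkSet w n | i + 1 ≠ p ∧ i ≠ p} := by
  ext i
  simp only [mem_insertPositions, lpkSet, Finset.mem_filter, Finset.mem_range,
    mul_insertCycle_apply hfix]
  have h0 := fun i => apply_lt_of_fix hfix (i := i)
  rcases lt_trichotomy i p with h | rfl | h
  · have := h0 i (by omega)
    simp only [show ¬ n < i by omega, show ¬ n < i + 1 by omega, show ¬ n < i - 1 by omega, h,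
      show i - 1 < p by omega, if_true, if_false, true_and]
    split_ifs <;> grind
  · have := h0 i (by omega)
    have := h0 (i - 1) (by omega)
    by_cases hi : i = 0
    · subst hi; simp [show 0 < n by omega]; grind
    simp [show ¬ n < i by omega, show ¬ n < i + 1 by omega, show ¬ n < i - 1 by omega,
      show i - 1 < i by omega]
    grind
  · by_cases h1 : n < i
    · simp [h1, show n < i + 1 by omega]
      grind
    · have := h0 (i - 1) (by omega)
      simp only [h1, show ¬ i < p by omega, show ¬ i + 1 < p by omega, show i ≠ p by omega,
        show i + 1 ≠ p by omega, if_false, Nat.add_sub_cancel, show i - 1 + 1 = i by omega,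
        show ¬ n < i - 1 by omega, show ¬ i - 1 < p by omega]
      by_cases h2 : n < i + 1
      · have := hfix i (by omega)
        simp only [h2, if_true]
        grind
      · simp only [h2, if_false]
        by_cases h3 : i - 1 = p
        · simp only [h3, if_true]; grind
        · simp only [h3, if_false]; grind

theorem card_desSet_insertCycle (hfix : ∀ i, n ≤ i → w i = i) (hp : p < n) (hN : n < N) :
    (desSet (w * insertCycle n p : Perm ℕ) N).card =
      if p ∈ (desSet w n).image Nat.succ then (desSet w n).card else (desSet w n).card + 1 := by
  rw [desSet_insertCycle hfix hp hN, card_insertPositions]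
  split_ifs with h
  · obtain ⟨j, hj, rfl⟩ := Finset.mem_image.1 h
    have : {i ∈ desSet w n | i + 1 ≠ j.succ} = (desSet w n).erase j := by
      ext i; simp only [Finset.mem_filter, Finset.mem_erase]; grind
    rw [this, Finset.card_erase_add_one hj]
  · rw [Finset.filter_true_of_mem]
    rintro i hi rfl
    exact h (Finset.mem_image_of_mem _ hi)

/-- If `L` contains no two consecutive positions, then at most one element of `L` is next to the
gap `p`. -/
theorem card_filter_add_one_of_no_consecutive {L : Finset ℕ} (hL : ∀ i ∈ L, i + 1 ∉ L) (p : ℕ) :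
    {i ∈ L | i + 1 ≠ p ∧ i ≠ p}.card + 1 =
      if p ∈ L ∪ L.image Nat.succ then L.card else L.card + 1 := by
  split_ifs with h
  · rcases Finset.mem_union.1 h with h | h
    · have : {i ∈ L | i + 1 ≠ p ∧ i ≠ p} = L.erase p := by
        ext i; simp only [Finset.mem_filter, Finset.mem_erase]; grind
      rw [this, Finset.card_erase_add_one h]
    · obtain ⟨j, hj, rfl⟩ := Finset.mem_image.1 h
      have : {i ∈ L | i + 1 ≠ j.succ ∧ i ≠ j.succ} = L.erase j := by
        ext i; simp only [Finset.mem_filter, Finset.mem_erase]; grind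
      rw [this, Finset.card_erase_add_one hj]
  · rw [Finset.filter_true_of_mem]
    intro i hi
    simp only [Finset.mem_union, Finset.mem_image, not_or, not_exists, not_and] at h
    exact ⟨fun e => h.2 i hi e, fun e => h.1 (e ▸ hi)⟩

theorem card_union_image_succ {L : Finset ℕ} (hL : ∀ i ∈ L, i + 1 ∉ L) :
    (L ∪ L.image Nat.succ).card = 2 * L.card := by
  rw [Finset.card_union_of_disjoint, Finset.card_image_of_injective _ Nat.succ_injective, two_mul]
  rw [Finset.disjoint_left]
  rintro i hi h
  obtain ⟨j, hj, rfl⟩ := Finset.mem_image.1 h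
  exact hL j hj hi

theorem card_lpkSet_insertCycle (hfix : ∀ i, n ≤ i → w i = i) (hp : p < n) (hN : n < N) :
    (lpkSet (w * insertCycle n p : Perm ℕ) N).card =
      if p ∈ lpkSet w n ∪ (lpkSet w n).image Nat.succ then (lpkSet w n).card
      else (lpkSet w n).card + 1 := by
  rw [lpkSet_insertCycle hfix hp hN, card_insertPositions,
    card_filter_add_one_of_no_consecutive fun _ => lpkSet_succ_notMem]

/-- The peaks are the left peaks other than the first position; a maximum inserted at the front is
not a peak, and destroys none. -/
theorem card_pkSet_insertCycle (hfix : ∀ i, n ≤ i → w i = i) (hp : p < n) (hN : n < N) :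
    (pkSet (w * insertCycle n p : Perm ℕ) N).card =
      if p ∈ insert 0 (pkSet w n ∪ (pkSet w n).image Nat.succ) then (pkSet w n).card
      else (pkSet w n).card + 1 := by
  rw [pkSet_eq_erase, lpkSet_insertCycle hfix hp hN]
  have hL : ∀ i ∈ pkSet w n, i + 1 ∉ pkSet w n := by
    simp only [pkSet_eq_erase, Finset.mem_erase]
    exact fun i hi h => lpkSet_succ_notMem hi.2 h.2
  rcases Nat.eq_zero_or_pos p with rfl | h
  · rw [if_pos (Finset.mem_insert_self _ _), insertPositions, Finset.erase_insert,
      card_image_shift, pkSet_eq_erase]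
    · congr 1
      ext i; simp only [Finset.mem_filter, Finset.mem_erase]; grind
    · rw [mem_image_shift]; omega
  · have h1 : (insertPositions p {i ∈ lpkSet w n | i + 1 ≠ p ∧ i ≠ p}).erase 0 =
        insertPositions p {i ∈ pkSet w n | i + 1 ≠ p ∧ i ≠ p} := by
      ext i
      simp only [mem_insertPositions, pkSet_eq_erase, Finset.mem_filter, Finset.mem_erase]
      grind
    simp only [h1, card_insertPositions, card_filter_add_one_of_no_consecutive hL,
      Finset.mem_insert, h.ne', false_or]

theorem image_succ_subset_range {S : Finset ℕ} (h : S ⊆ Finset.range (n - 1)) :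
    S.image Nat.succ ⊆ Finset.range n := by
  intro i hi
  obtain ⟨j, hj, rfl⟩ := Finset.mem_image.1 hi
  have := Finset.mem_range.1 (h hj)
  exact Finset.mem_range.2 (by omega)

theorem sum_desSet_insertCycle (hfix : ∀ i, n ≤ i → w i = i) (hN : n < N) (F : ℕ → ℝ) :
    ∑ p ∈ Finset.range n, F (desSet (w * insertCycle n p : Perm ℕ) N).card =
      (desSet w n).card * F (desSet w n).card +
        (n - (desSet w n).card) * F ((desSet w n).card + 1) := by
  rw [sum_range_eq_of_eq_ite (image_succ_subset_range (desSet_subset hfix))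
    (fun p hp => card_desSet_insertCycle hfix hp hN),
    Finset.card_image_of_injective _ Nat.succ_injective]

theorem sum_lpkSet_insertCycle (hfix : ∀ i, n ≤ i → w i = i) (hN : n < N) (F : ℕ → ℝ) :
    ∑ p ∈ Finset.range n, F (lpkSet (w * insertCycle n p : Perm ℕ) N).card =
      (2 * (lpkSet w n).card) * F (lpkSet w n).card +
        (n - 2 * (lpkSet w n).card) * F ((lpkSet w n).card + 1) := by
  have hsub := (lpkSet_subset_desSet w n).trans (desSet_subset hfix)
  rw [sum_range_eq_of_eq_ite (Finset.union_subset
      (hsub.trans (Finset.range_subset_range.2 (Nat.sub_le _ _))) (image_succ_subset_range hsub))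
    (fun p hp => card_lpkSet_insertCycle hfix hp hN),
    card_union_image_succ fun _ => lpkSet_succ_notMem]
  push_cast
  ring

theorem sum_pkSet_insertCycle (hfix : ∀ i, n ≤ i → w i = i) (hn : 0 < n) (hN : n < N)
    (F : ℕ → ℝ) :
    ∑ p ∈ Finset.range n, F (pkSet (w * insertCycle n p : Perm ℕ) N).card =
      (2 * (pkSet w n).card + 1) * F (pkSet w n).card +
        (n - (2 * (pkSet w n).card + 1)) * F ((pkSet w n).card + 1) := by
  have hsub : pkSet w n ⊆ Finset.range (n - 1) := by
    rw [pkSet_eq_erase]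
    exact (Finset.erase_subset _ _).trans ((lpkSet_subset_desSet w n).trans (desSet_subset hfix))
  have hL : ∀ i ∈ pkSet w n, i + 1 ∉ pkSet w n := by
    simp only [pkSet_eq_erase, Finset.mem_erase]
    exact fun i hi h => lpkSet_succ_notMem hi.2 h.2
  rw [sum_range_eq_of_eq_ite (Finset.insert_subset (Finset.mem_range.2 hn) (Finset.union_subset
      (hsub.trans (Finset.range_subset_range.2 (Nat.sub_le _ _))) (image_succ_subset_range hsub)))
    (fun p hp => card_pkSet_insertCycle hfix hp hN),
    Finset.card_insert_of_notMem, card_union_image_succ hL]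
  · push_cast
    ring
  · simp [pkSet_eq_erase]

end Insert

end StirlingClusters

namespace StirlingClusters

open Equiv

/-! ### Clusters as permutations of the natural numbers -/

/-- The extension of a permutation of `Fin n` to `ℕ` by fixed points. -/
def extend {n : ℕ} (π : Perm (Fin n)) : Perm ℕ := π.extendDomain Fin.equivSubtype

theorem extend_apply_val {n : ℕ} (π : Perm (Fin n)) (i : Fin n) : extend π i = π i :=
  Perm.extendDomain_apply_image π Fin.equivSubtype i

theorem extend_apply_of_le {n : ℕ} (π : Perm (Fin n)) {i : ℕ} (h : n ≤ i) : extend π i = i :=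
  Perm.extendDomain_apply_not_subtype π Fin.equivSubtype h.not_gt

theorem extend_inv {n : ℕ} (π : Perm (Fin n)) : extend π⁻¹ = (extend π)⁻¹ :=
  (Perm.extendDomain_inv π Fin.equivSubtype).symm

theorem extend_injective (n : ℕ) : Function.Injective (extend : Perm (Fin n) → Perm ℕ) :=
  Perm.extendDomainHom_injective Fin.equivSubtype

theorem exists_extend_eq {n : ℕ} {σ : Perm ℕ} (h : ∀ i, n ≤ i → σ i = i) :
    ∃ π : Perm (Fin n), extend π = σ := by
  have hlt : ∀ i : Fin n, σ i < n := fun i => apply_lt_of_fix h i.2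
  have hinj : Function.Injective (fun i : Fin n => (⟨σ i, hlt i⟩ : Fin n)) := by
    intro i j hij
    exact Fin.ext (σ.injective (congrArg Fin.val hij))
  refine ⟨Equiv.ofBijective _ (Finite.injective_iff_bijective.1 hinj), ?_⟩
  ext i
  by_cases hi : i < n
  · exact extend_apply_val _ ⟨i, hi⟩
  · rw [extend_apply_of_le _ (not_lt.1 hi), h i (not_lt.1 hi)]

/-- The pattern `2134⋯` is the identity with its first two letters exchanged. -/
theorem std_eq_pattern_iff {m : ℕ} (hm : 2 ≤ m) {w : Fin (m + 1) → ℕ} :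
    std w = pattern (m + 1) ↔ StrictMono (w ∘ swap (0 : Fin (m + 1)) 1) := by
  have hpat : ∀ i : Fin (m + 1), pattern (m + 1) i = (swap (0 : Fin (m + 1)) 1 i : ℕ) + 1 := by
    intro i
    have h1 : ((1 : Fin (m + 1)) : ℕ) = 1 :=
      (Fin.val_one' (m + 1)).trans (Nat.mod_eq_of_lt (by omega))
    rw [pattern, swap_apply_def]
    simp only [Fin.ext_iff, h1, Fin.val_zero]
    split_ifs <;> simp_all
  have hstd : ∀ i j, std w i < std w j → w i < w j := by
    intro i j h
    by_contra! h1
    refine absurd h (not_lt.2 (Nat.succ_le_succ (Finset.card_le_card fun a ha => ?_)))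
    simp only [Finset.mem_filter, Finset.mem_univ, true_and] at ha ⊢
    omega
  set s := swap (0 : Fin (m + 1)) 1 with hs
  constructor
  · intro h a b hab
    refine hstd _ _ ?_
    rw [h, hpat, hpat]
    simpa [s] using hab
  · intro h
    funext i
    rw [hpat, std]
    congr 1
    have : (Finset.univ.filter fun j : Fin (m + 1) => w j < w i) =
        (Finset.Iio (s i)).map s.toEmbedding := by
      ext j
      simp only [Finset.mem_filter, Finset.mem_univ, true_and, Finset.mem_map_equiv,
        Finset.mem_Iio]
      have := h.lt_iff_lt (a := s j) (b := s i)
      simpa [s] using this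
    rw [this, Finset.card_map, Fin.card_Iio]

theorem strictMono_comp_swap_iff {r : ℕ} (hr : 2 ≤ r) {w : ℕ → ℕ} :
    StrictMono ((fun i : Fin (r + 1) => w i) ∘ swap (0 : Fin (r + 1)) 1) ↔
      w 1 < w 0 ∧ w 0 < w 2 ∧ ∀ i, 2 ≤ i → i < r → w i < w (i + 1) := by
  obtain ⟨r, rfl⟩ : ∃ q, r = q + 2 := ⟨r - 2, by omega⟩
  rw [Fin.strictMono_iff_lt_succ]
  have h1 : ((1 : Fin (r + 2 + 1)) : ℕ) = 1 := rfl
  have hval : ∀ i : Fin (r + 2 + 1), ((swap (0 : Fin (r + 2 + 1)) 1 i : Fin _) : ℕ) =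
      if (i : ℕ) = 0 then 1 else if (i : ℕ) = 1 then 0 else i := by
    intro i
    rw [swap_apply_def]
    simp only [Fin.ext_iff, h1, Fin.val_zero]
  simp only [Function.comp, hval, Fin.val_castSucc, Fin.val_succ]
  constructor
  · intro h
    refine ⟨by simpa using h ⟨0, by omega⟩, h ⟨1, by omega⟩, fun i h2 hi => ?_⟩
    have := h ⟨i, hi⟩
    simpa [show i ≠ 0 by omega, show i ≠ 1 by omega] using this
  · rintro ⟨ha, hb, hc⟩ ⟨i, hi⟩
    rcases i with _ | _ | i
    · simpa using ha
    · exact hb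
    · simpa using hc (i + 2) (by omega) hi

/-- `τ` is the extension to `ℕ` of a `2134⋯(r+1)`-cluster with `k` blocks: it fixes everything
from `r k + 1` on, and the inequalities of the pattern hold in each block. -/
structure IsNatCluster (r k : ℕ) (τ : Perm ℕ) : Prop where
  fix : ∀ i, r * k + 1 ≤ i → τ i = i
  one_lt_zero : ∀ j < k, τ (r * j + 1) < τ (r * j)
  zero_lt_two : ∀ j < k, τ (r * j) < τ (r * j + 2)
  lt_succ : ∀ j < k, ∀ i, 2 ≤ i → i < r → τ (r * j + i) < τ (r * j + i + 1)

theorem isCluster_iff {r k : ℕ} (hr : 2 ≤ r) (τ : Perm (Fin (r * k + 1))) :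
    IsCluster (r + 1) k τ ↔ IsNatCluster r k (extend τ) := by
  have key : ∀ j < k, OccursAt (pattern (r + 1)) τ ((r + 1 - 1) * j) ↔
      extend τ (r * j + 1) < extend τ (r * j) ∧ extend τ (r * j) < extend τ (r * j + 2) ∧
        ∀ i, 2 ≤ i → i < r → extend τ (r * j + i) < extend τ (r * j + i + 1) := by
    intro j hj
    have hle : (r + 1 - 1) * j + (r + 1) ≤ r * k + 1 := by
      have : r * (j + 1) ≤ r * k := Nat.mul_le_mul_left r hj
      rw [Nat.add_sub_cancel]; rw [mul_add] at this; omega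
    have hw : (fun i : Fin (r + 1) => letter τ ⟨(r + 1 - 1) * j + i, by omega⟩) =
        fun i : Fin (r + 1) => (fun i : ℕ => extend τ (r * j + i) + 1) i := by
      funext i
      have h := extend_apply_val τ ⟨r * j + i, by rw [Nat.add_sub_cancel] at hle; omega⟩
      simp only [letter, Nat.add_sub_cancel] at h ⊢
      rw [h]
    rw [OccursAt, exists_prop_of_true hle, hw, std_eq_pattern_iff hr,
      strictMono_comp_swap_iff hr (w := fun i : ℕ => extend τ (r * j + i) + 1)]
    simp only [add_lt_add_iff_right, add_zero, add_assoc]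
  constructor
  · rintro ⟨-, h⟩
    exact ⟨fun i hi => extend_apply_of_le τ hi, fun j hj => ((key j hj).1 (h j hj)).1,
      fun j hj => ((key j hj).1 (h j hj)).2.1, fun j hj => ((key j hj).1 (h j hj)).2.2⟩
  · intro h
    exact ⟨rfl, fun j hj => (key j hj).2
      ⟨h.one_lt_zero j hj, h.zero_lt_two j hj, h.lt_succ j hj⟩⟩

theorem IsNatCluster.apply_zero_lt {r k : ℕ} {τ : Perm ℕ} (h : IsNatCluster r k τ) {j : ℕ}
    (hj : j < k) {i : ℕ} (h2 : 2 ≤ i) (hi : i ≤ r) : τ (r * j) < τ (r * j + i) := by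
  induction i, h2 using Nat.le_induction with
  | base => exact h.zero_lt_two j hj
  | succ i h2 ih => exact (ih (by omega)).trans (h.lt_succ j hj i h2 (by omega))

/-- The first letter of a block is a record. -/
theorem IsNatCluster.apply_le_last {r k : ℕ} (hr : 2 ≤ r) {τ : Perm ℕ}
    (h : IsNatCluster r k τ) {j : ℕ} (hj : j ≤ k) {i : ℕ} (hi : i ≤ r * j) :
    τ i ≤ τ (r * j) := by
  induction j generalizing i with
  | zero => rw [show i = r * 0 by omega]
  | succ j ih =>
    have hlt : τ (r * j) < τ (r * (j + 1)) := h.apply_zero_lt (by omega) hr le_rfl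
    rcases le_or_gt i (r * j) with h1 | h1
    · exact (ih (by omega) h1).trans hlt.le
    · obtain ⟨d, rfl⟩ := Nat.exists_eq_add_of_lt h1
      rw [mul_add] at hi ⊢
      have key : ∀ d', 2 ≤ d + 1 → d + 1 ≤ d' → d' ≤ r → τ (r * j + (d + 1)) ≤ τ (r * j + d') := by
        intro d' h2 hd
        induction d', hd using Nat.le_induction with
        | base => intro _; exact le_rfl
        | succ d' hd ih2 =>
          intro hr'
          exact (ih2 (by omega)).trans (h.lt_succ j (by omega) d' (by omega) (by omega)).le
      rcases Nat.eq_zero_or_pos d with rfl | hd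
      · rw [mul_add] at hlt
        simpa using ((h.one_lt_zero j (by omega)).trans hlt).le
      · have := key r (by omega) (by omega) le_rfl
        simpa [add_assoc] using this

/-- A permutation all of whose values from `N` on are records fixes everything from `N` on. -/
theorem apply_eq_self_of_records {τ : Perm ℕ} {N : ℕ} (h : ∀ m, N ≤ m → ∀ i < m, τ i < τ m)
    {m : ℕ} (hm : N ≤ m) : τ m = m := by
  have : (Finset.range m).map τ.toEmbedding = Finset.range (τ m) := by
    ext v
    simp only [Finset.mem_map_equiv, Finset.mem_range]
    constructor
    · intro hv
      simpa using h m hm _ hv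
    · intro hv
      by_contra! h1
      rcases h1.eq_or_lt with h2 | h2
      · rw [h2] at hv; simp at hv
      · have := h _ (hm.trans h1) _ h2
        rw [Equiv.apply_symm_apply] at this
        omega
  simpa using (congrArg Finset.card this).symm

theorem IsNatCluster.fix_last {r k : ℕ} (hr : 2 ≤ r) {τ : Perm ℕ} (h : IsNatCluster r k τ) :
    τ (r * k) = r * k := by
  refine apply_eq_self_of_records (N := r * k) (fun m hm i hi => ?_) le_rfl
  rcases hm.eq_or_lt with rfl | hm
  · exact lt_of_le_of_ne (h.apply_le_last hr le_rfl hi.le) (fun e => hi.ne (τ.injective e))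
  · rw [h.fix m hm]
    by_cases h1 : r * k + 1 ≤ i
    · rwa [h.fix i h1]
    · have := apply_lt_of_fix h.fix (not_le.1 h1)
      omega

/-- In a cluster with `k + 1` blocks only the second letter of the last block is free: the letters
after it are the largest ones in increasing order. -/
theorem IsNatCluster.fix_of_lt {r k : ℕ} (hr : 2 ≤ r) {τ : Perm ℕ}
    (h : IsNatCluster r (k + 1) τ) {m : ℕ} (hm : r * k + 2 ≤ m) : τ m = m := by
  refine apply_eq_self_of_records (N := r * k + 2) (fun m hm i hi => ?_) hm
  have hmul : r * (k + 1) = r * k + r := mul_add_one r k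
  have hfix := h.fix
  rw [hmul] at hfix
  by_cases h1 : r * k + r + 1 ≤ m
  · rw [hfix m h1]
    by_cases h2 : r * k + r + 1 ≤ i
    · rwa [hfix i h2]
    · have := apply_lt_of_fix hfix (not_le.1 h2)
      omega
  · have h0 : ∀ d, 2 ≤ d → d ≤ r → ∀ i < r * k + d, τ i < τ (r * k + d) := by
      intro d h2
      induction d, h2 using Nat.le_induction with
      | base =>
        intro _ i hi
        have hz := h.zero_lt_two k (by omega)
        rcases Nat.lt_or_ge i (r * k + 1) with h3 | h3
        · exact (h.apply_le_last hr (by omega) (by omega)).trans_lt hz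
        · rw [show i = r * k + 1 by omega]
          exact (h.one_lt_zero k (by omega)).trans hz
      | succ d h2 ih =>
        intro hd i hi
        have hs := h.lt_succ k (by omega) d h2 (by omega)
        rcases Nat.lt_or_ge i (r * k + d) with h3 | h3
        · exact (ih (by omega) i h3).trans hs
        · rw [show i = r * k + d by omega]
          exact hs
    obtain ⟨d, rfl⟩ := Nat.exists_eq_add_of_le (show r * k ≤ m by omega)
    exact h0 d (by omega) (by omega) i hi

theorem insertCycle_inv_mul_lt_iff {τ : Perm ℕ} {n p i j : ℕ} (hn : τ n = n) (hi : i ≠ n)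
    (hj : j ≠ n) :
    ((insertCycle n p)⁻¹ * τ) i < ((insertCycle n p)⁻¹ * τ) j ↔ τ i < τ j := by
  rw [Perm.mul_apply, Perm.mul_apply]
  exact insertCycle_inv_lt_iff (fun e => hi (τ.injective (e.trans hn.symm)))
    (fun e => hj (τ.injective (e.trans hn.symm)))

theorem mul_add_le_mul_of_lt {r j k i : ℕ} (hj : j < k) (hi : i ≤ r) : r * j + i ≤ r * k := by
  have : r * (j + 1) ≤ r * k := Nat.mul_le_mul_left r hj
  rw [mul_add] at this; omega

/-- Composing a cluster with the inverse of `insertCycle` raises its letters from `p` on by one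
and puts `p` after them, as the second letter of one more block. -/
theorem isNatCluster_insert {r k p : ℕ} (hr : 2 ≤ r) {τ : Perm ℕ} (h : IsNatCluster r k τ)
    (hp : p < r * k + 1) :
    IsNatCluster r (k + 1) ((insertCycle (r * k + 1) p)⁻¹ * τ) := by
  have hn := h.fix _ le_rfl
  have hmul : r * (k + 1) = r * k + r := mul_add_one r k
  have hfix : ∀ i, r * k + 2 ≤ i → ((insertCycle (r * k + 1) p)⁻¹ * τ) i = i := by
    intro i hi
    rw [Perm.mul_apply, h.fix i (by omega), insertCycle_inv_apply, if_pos (by omega)]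
  have h0 : ((insertCycle (r * k + 1) p)⁻¹ * τ) (r * k) = r * k + 1 := by
    rw [Perm.mul_apply, h.fix_last hr, insertCycle_inv_apply, if_neg (by omega),
      if_neg (by omega)]
  have h1 : ((insertCycle (r * k + 1) p)⁻¹ * τ) (r * k + 1) = p := by
    rw [Perm.mul_apply, hn, insertCycle_inv_apply, if_neg (by omega), if_pos rfl]
  refine ⟨fun i hi => hfix i (by omega), fun j hj => ?_, fun j hj => ?_, fun j hj i h2 hi => ?_⟩
  all_goals rcases Nat.lt_succ_iff_lt_or_eq.1 hj with hj | rfl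
  · have := mul_add_le_mul_of_lt hj (show 1 ≤ r by omega)
    exact (insertCycle_inv_mul_lt_iff hn (by omega) (by omega)).2 (h.one_lt_zero j hj)
  · rw [h0, h1]; exact hp
  · have := mul_add_le_mul_of_lt hj hr
    exact (insertCycle_inv_mul_lt_iff hn (by omega) (by omega)).2 (h.zero_lt_two j hj)
  · rw [h0, hfix _ le_rfl]; omega
  · have := mul_add_le_mul_of_lt hj (show i + 1 ≤ r by omega)
    exact (insertCycle_inv_mul_lt_iff hn (by omega) (by omega)).2 (h.lt_succ j hj i h2 hi)
  · rw [hfix _ (by omega), hfix _ (by omega)]; omega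

/-- Every cluster with at least one block arises by insertion, with `p` the second letter of its
last block. -/
theorem IsNatCluster.exists_eq_insert {r k : ℕ} (hr : 2 ≤ r) {τ : Perm ℕ}
    (h : IsNatCluster r (k + 1) τ) :
    ∃ p < r * k + 1, ∃ σ, IsNatCluster r k σ ∧ τ = (insertCycle (r * k + 1) p)⁻¹ * σ := by
  set p := τ (r * k + 1) with hpdef
  have hfix : ∀ i, r * k + 2 ≤ i → τ i = i := fun i hi => h.fix_of_lt hr hi
  have hp : p < r * k + 1 := by
    have h1 := h.one_lt_zero k (by omega)
    have h2 := apply_lt_of_fix hfix (i := r * k) (by omega)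
    omega
  refine ⟨p, hp, insertCycle (r * k + 1) p * τ, ?_, by group⟩
  have hn : (insertCycle (r * k + 1) p * τ) (r * k + 1) = r * k + 1 := by
    rw [Perm.mul_apply, ← hpdef, insertCycle_apply, if_neg (by omega), if_pos rfl]
  have hlt : ∀ {i j}, i ≠ r * k + 1 → j ≠ r * k + 1 →
      ((insertCycle (r * k + 1) p * τ) i < (insertCycle (r * k + 1) p * τ) j ↔ τ i < τ j) := by
    intro i j hi hj
    rw [← insertCycle_inv_mul_lt_iff (p := p) hn hi hj, inv_mul_cancel_left]
  refine ⟨fun i hi => ?_, fun j hj => ?_, fun j hj => ?_, fun j hj i h2 hi => ?_⟩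
  · rcases hi.eq_or_lt with rfl | hi
    · exact hn
    · rw [Perm.mul_apply, hfix i hi, insertCycle_apply, if_pos (by omega)]
  · have := mul_add_le_mul_of_lt hj (show 1 ≤ r by omega)
    exact (hlt (by omega) (by omega)).2 (h.one_lt_zero j (by omega))
  · have := mul_add_le_mul_of_lt hj hr
    exact (hlt (by omega) (by omega)).2 (h.zero_lt_two j (by omega))
  · have := mul_add_le_mul_of_lt hj (show i + 1 ≤ r by omega)
    exact (hlt (by omega) (by omega)).2 (h.lt_succ j (by omega) i h2 hi)

open Classical in
/-- The extensions to `ℕ` of the elements of `𝒫_{r,k}`. -/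
noncomputable def natP (r k : ℕ) : Finset (Perm ℕ) := (P r k).image extend

theorem mem_natP {r k : ℕ} (hr : 2 ≤ r) {σ : Perm ℕ} :
    σ ∈ natP r k ↔ IsNatCluster r k σ⁻¹ := by
  simp only [natP, P, Finset.mem_image, Finset.mem_filter, Finset.mem_univ, true_and,
    isCluster_iff hr, extend_inv]
  constructor
  · rintro ⟨π, hπ, rfl⟩
    exact hπ
  · intro h
    obtain ⟨π, rfl⟩ := exists_extend_eq (n := r * k + 1) (σ := σ) fun i hi => by
      conv_lhs => rw [← h.fix i hi]
      simp
    exact ⟨π, h, rfl⟩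

theorem fix_of_mem_natP {r k : ℕ} {σ : Perm ℕ} (h : σ ∈ natP r k) (i : ℕ)
    (hi : r * k + 1 ≤ i) : σ i = i := by
  classical
  obtain ⟨π, -, rfl⟩ := Finset.mem_image.1 h
  exact extend_apply_of_le π hi

/-- Each element of `𝒫_{r,k+1}` arises exactly once from an element of `𝒫_{r,k}` by inserting the
letter `r k + 2` before the last letter; the letters after `r k + 2` are fixed points. -/
theorem sum_natP_succ {r : ℕ} (hr : 2 ≤ r) (k : ℕ) (G : Perm ℕ → ℝ) :
    ∑ σ ∈ natP r (k + 1), G σ =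
      ∑ σ ∈ natP r k, ∑ p ∈ Finset.range (r * k + 1), G (σ * insertCycle (r * k + 1) p) := by
  rw [← Finset.sum_product']
  symm
  refine Finset.sum_nbij (fun x => x.1 * insertCycle (r * k + 1) x.2) ?_ ?_ ?_ fun _ _ => rfl
  · rintro ⟨σ, p⟩ h
    rw [Finset.mem_product, Finset.mem_range, mem_natP hr] at h
    rw [mem_natP hr, mul_inv_rev]
    exact isNatCluster_insert hr h.1 h.2
  · rintro ⟨σ, p⟩ h ⟨σ', p'⟩ h' e
    rw [Finset.mem_coe, Finset.mem_product, Finset.mem_range] at h h'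
    dsimp only at h h' e
    -- the position of the letter `r k + 2` determines `p`
    have hpos : ∀ {σ : Perm ℕ} {p : ℕ}, σ ∈ natP r k → p < r * k + 1 →
        (σ * insertCycle (r * k + 1) p)⁻¹ (r * k + 1) = p := by
      intro σ p hσ hp
      rw [mul_inv_rev, Perm.mul_apply, ((mem_natP hr).1 hσ).fix _ le_rfl, insertCycle_inv_apply,
        if_neg (by omega), if_pos rfl]
    have hpp : p = p' := by rw [← hpos h.1 h.2, e, hpos h'.1 h'.2]
    subst hpp
    rw [mul_right_cancel e]
  · intro σ h
    rw [Finset.mem_coe, mem_natP hr] at h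
    obtain ⟨p, hp, τ, hτ, e⟩ := h.exists_eq_insert hr
    refine ⟨(τ⁻¹, p), ?_, ?_⟩
    · rw [Finset.mem_coe, Finset.mem_product, Finset.mem_range, mem_natP hr, inv_inv]
      exact ⟨hτ, hp⟩
    · rw [← inv_inj, e]
      simp

/-! ### The statistics of a permutation and of its extension -/

theorem card_filter_fin {n : ℕ} {p : Fin n → Prop} {q : ℕ → Prop} [DecidablePred p]
    [DecidablePred q] (h : ∀ i : Fin n, p i ↔ q i) :
    (Finset.univ.filter p).card = ((Finset.range n).filter q).card := by
  refine Finset.card_bij (fun i _ => (i : ℕ)) ?_ ?_ ?_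
  · intro i hi
    simpa [h] using hi
  · intro i _ j _ hij
    exact Fin.ext hij
  · intro i hi
    rw [Finset.mem_filter, Finset.mem_range] at hi
    exact ⟨⟨i, hi.1⟩, by simpa [h] using hi.2, rfl⟩

section Extend

variable {n : ℕ} (π : Perm (Fin n))

/-- The last letter of `π` is not a descent of the extension, as a fixed point `n` follows it. -/
theorem isDescent_iff (i : Fin n) : IsDescent π i ↔ extend π (i + 1) < extend π i := by
  rw [IsDescent]
  by_cases h : (i : ℕ) + 1 < n
  · rw [exists_prop_of_true h, extend_apply_val π i]
    have := extend_apply_val π ⟨i + 1, h⟩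
    simp only at this
    rw [this, letter, letter, add_lt_add_iff_right]
  · rw [extend_apply_of_le π (not_lt.1 h), extend_apply_val]
    have := (π i).2
    simp only [h, IsEmpty.exists_iff, false_iff]
    omega

theorem isPeak_iff (i : Fin n) : IsPeak π i ↔
    (i : ℕ) ≠ 0 ∧ extend π (i - 1) < extend π i ∧ extend π (i + 1) < extend π i := by
  have hd := isDescent_iff π i
  have hl := extend_apply_val π ⟨i - 1, by omega⟩
  have hi := extend_apply_val π i
  simp only at hl
  rw [← hd, IsDescent, IsPeak, hl, hi]
  simp only [letter, add_lt_add_iff_right, ← Nat.one_le_iff_ne_zero]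
  exact ⟨fun ⟨h1, h2, h3, h4⟩ => ⟨h1, h3, h2, h4⟩, fun ⟨h1, h3, h2, h4⟩ => ⟨h1, h2, h3, h4⟩⟩

theorem isLeftPeak_iff (i : Fin n) : IsLeftPeak π i ↔
    ((i : ℕ) = 0 ∨ extend π (i - 1) < extend π i) ∧ extend π (i + 1) < extend π i := by
  rw [IsLeftPeak, isPeak_iff, isDescent_iff]
  tauto

theorem des_eq_card : des π = (desSet (extend π) n).card := by
  classical exact card_filter_fin (isDescent_iff π)

theorem pk_eq_card : pk π = (pkSet (extend π) n).card := by
  classical exact card_filter_fin (isPeak_iff π)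

theorem lpk_eq_card : lpk π = (lpkSet (extend π) n).card := by
  classical exact card_filter_fin (isLeftPeak_iff π)

theorem pk_eq_zero (hn : n ≤ 1) : pk π = 0 := by
  classical
  refine Finset.card_eq_zero.2 (Finset.filter_false_of_mem ?_)
  rintro i - ⟨-, h, -⟩
  omega

theorem lpk_eq_zero (hn : n ≤ 1) : lpk π = 0 := by
  classical
  refine Finset.card_eq_zero.2 (Finset.filter_false_of_mem ?_)
  rintro i - (⟨-, h, -⟩ | ⟨-, h, -⟩) <;> omega

end Extend

theorem sum_P_extend (r k : ℕ) (G : Perm ℕ → ℝ) :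
    ∑ π ∈ P r k, G (extend π) = ∑ σ ∈ natP r k, G σ := by
  classical
  rw [natP, Finset.sum_image fun _ _ _ _ h => extend_injective _ h]

/-- It suffices to count the gaps for the position sets `S` of a single permutation of `ℕ`. -/
theorem growsByInsertion_of_sum {r : ℕ} (hr : 2 ≤ r) {a b : ℝ} (S : (ℕ → ℕ) → ℕ → Finset ℕ)
    (hS : ∀ {σ : Perm ℕ} {n : ℕ}, (∀ i, n ≤ i → σ i = i) → 0 < n → ∀ {N}, n < N → ∀ F : ℕ → ℝ,
      ∑ p ∈ Finset.range n, F (S (σ * insertCycle n p : Perm ℕ) N).card =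
        (a * (S σ n).card + b) * F (S σ n).card +
          (n - (a * (S σ n).card + b)) * F ((S σ n).card + 1)) :
    GrowsByInsertion (P r) (fun k π => (S (extend π) (r * k + 1)).card) r a b := by
  intro F k
  rw [sum_P_extend r (k + 1) fun σ => F (S σ (r * (k + 1) + 1)).card,
    sum_P_extend r k fun σ => (a * (S σ (r * k + 1)).card + b) * F (S σ (r * k + 1)).card +
      ((r : ℝ) * k + 1 - (a * (S σ (r * k + 1)).card + b)) * F ((S σ (r * k + 1)).card + 1),
    sum_natP_succ hr k]
  refine Finset.sum_congr rfl fun σ hσ => ?_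
  rw [hS (fix_of_mem_natP hσ) (Nat.succ_pos _) (by rw [mul_add]; omega) F]
  push_cast
  rfl

theorem growsByInsertion_des {r : ℕ} (hr : 2 ≤ r) :
    GrowsByInsertion (P r) (fun _ π => des π) r 1 0 := by
  simp only [des_eq_card]
  refine growsByInsertion_of_sum hr desSet fun hfix _ _ hN F => ?_
  simpa using sum_desSet_insertCycle hfix hN F

theorem growsByInsertion_pk {r : ℕ} (hr : 2 ≤ r) :
    GrowsByInsertion (P r) (fun _ π => pk π) r 2 1 := by
  simp only [pk_eq_card]
  exact growsByInsertion_of_sum hr pkSet fun hfix hn _ hN F => sum_pkSet_insertCycle hfix hn hN F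

theorem growsByInsertion_lpk {r : ℕ} (hr : 2 ≤ r) :
    GrowsByInsertion (P r) (fun _ π => lpk π) r 2 0 := by
  simp only [lpk_eq_card]
  refine growsByInsertion_of_sum hr lpkSet fun hfix _ _ hN F => ?_
  simpa using sum_lpkSet_insertCycle hfix hN F

theorem P_zero_nonempty (r : ℕ) : (P r 0).Nonempty :=
  ⟨1, by simp [P, IsCluster]⟩

/-! ### The means -/

theorem c_one {r : ℕ} (hr : 2 ≤ r) : c r 1 = 1 / (r + 2) := by
  have hr' : (0 : ℝ) < r := by positivity
  have hr0 : (r : ℝ) ≠ 0 := hr'.ne'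
  have hs : Real.sin (Real.pi / r) ≠ 0 := by
    refine (Real.sin_pos_of_pos_of_lt_pi (by positivity) ?_).ne'
    have h2 : (1 : ℝ) < r := by exact_mod_cast hr
    exact div_lt_self Real.pi_pos h2
  have hG : Real.Gamma (1 + 1 / r) ≠ 0 := (Real.Gamma_pos_of_pos (by positivity)).ne'
  have hG2 : Real.Gamma (1 / r) * Real.Gamma (1 - 1 / r) = Real.pi / Real.sin (Real.pi / r) := by
    rw [Real.Gamma_mul_Gamma_one_sub, mul_one_div]
  have hG1 : Real.Gamma (1 + 1 / r) = 1 / r * Real.Gamma (1 / r) := by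
    rw [add_comm, Real.Gamma_add_one (by positivity)]
  have hmul : Real.Gamma (1 + 1 / r) * Real.Gamma (1 - 1 / r) =
      Real.pi / (r * Real.sin (Real.pi / r)) := by
    rw [hG1, mul_assoc, hG2]; field_simp
  have hpi := Real.pi_ne_zero
  rw [c, Nat.cast_one, div_eq_div_iff (by positivity) (by positivity)]
  calc (r : ℝ) * Real.sin (Real.pi / r) * Real.Gamma (1 + 1 / r) ^ 2 * Real.Gamma (1 - 1 / r) *
        (r + 2) = r * Real.sin (Real.pi / r) * (r + 2) * Real.Gamma (1 + 1 / r) *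
        (Real.Gamma (1 + 1 / r) * Real.Gamma (1 - 1 / r)) := by ring
    _ = _ := by rw [hmul]; field_simp

theorem c_succ {r : ℕ} (hr : 2 ≤ r) {k : ℕ} (hk : 1 ≤ k) :
    c r (k + 1) = (1 - 2 / ((r : ℝ) * k + 1)) * c r k := by
  have hr2 : (2 : ℝ) ≤ r := by exact_mod_cast hr
  have hk1 : (1 : ℝ) ≤ k := by exact_mod_cast hk
  have hr' : (0 : ℝ) < r := by positivity
  have hlt : 1 / (r : ℝ) < 1 := by rw [div_lt_one hr']; linarith
  have h1 : (0 : ℝ) < k - 1 / r := by linarith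
  have h2 : (0 : ℝ) < k + 1 / r := by positivity
  have hG := (Real.Gamma_pos_of_pos h2).ne'
  have e1 : ((k + 1 : ℕ) : ℝ) - 1 / r = (k - 1 / r) + 1 := by push_cast; ring
  have e2 : ((k + 1 : ℕ) : ℝ) + 1 / r = (k + 1 / r) + 1 := by push_cast; ring
  have e3 : 1 - 2 / ((r : ℝ) * k + 1) = (k - 1 / r) / (k + 1 / r) := by field_simp; ring
  rw [c, c, e1, e2, Real.Gamma_add_one h1.ne', Real.Gamma_add_one h2.ne', e3, div_mul_div_comm]
  congr 1 <;> ring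

theorem mean_Cdes_succ {r : ℕ} (hr : 2 ≤ r) (k : ℕ) :
    mean (Cdes r (k + 1)) = ((r : ℝ) * (k + 1 : ℕ) + 1) / (r + 1) := by
  have h := (growsByInsertion_des hr).mean_succ (P_zero_nonempty r)
  induction k with
  | zero =>
    refine (h 0).trans ?_
    have : (r : ℝ) + 1 ≠ 0 := by positivity
    field_simp
    simp
  | succ k ih =>
    refine (h (k + 1)).trans ?_
    change (1 - _) * mean (Cdes r (k + 1)) + _ = _
    rw [ih]
    push_cast
    field_simp
    ring

theorem mean_Cpk_succ {r : ℕ} (hr : 2 ≤ r) (k : ℕ) :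
    mean (Cpk r (k + 1)) = ((2 * ((k + 1 : ℕ) : ℝ) - 1) * r) / (2 * (r + 2)) -
      (r : ℝ) / 2 * c r (k + 1) := by
  have h := (growsByInsertion_pk hr).mean_succ (P_zero_nonempty r)
  -- for `k = 0` the coefficient in the recurrence is `-1`, so the initial mean matters
  have h0 : mean (∑ π ∈ P r 0, (Polynomial.X : Polynomial ℝ) ^ pk π) = 0 := by
    rw [mean_sum_X_pow, Finset.sum_eq_zero, zero_div]
    intro π _
    rw [pk_eq_zero π (by simp), Nat.cast_zero]
  induction k with
  | zero =>
    refine (h 0).trans ?_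
    rw [h0, c_one hr]
    field_simp
    push_cast
    ring
  | succ k ih =>
    refine (h (k + 1)).trans ?_
    change (1 - _) * mean (Cpk r (k + 1)) + _ = _
    rw [ih, c_succ hr (Nat.succ_pos k)]
    push_cast
    field_simp
    ring

theorem mean_Clpk_succ {r : ℕ} (hr : 2 ≤ r) (k : ℕ) :
    mean (Clpk r (k + 1)) = ((r : ℝ) * (k + 1 : ℕ) + 1) / (r + 2) + c r (k + 1) := by
  have h := (growsByInsertion_lpk hr).mean_succ (P_zero_nonempty r)
  -- for `k = 0` the coefficient in the recurrence is `-1`, so the initial mean matters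
  have h0 : mean (∑ π ∈ P r 0, (Polynomial.X : Polynomial ℝ) ^ lpk π) = 0 := by
    rw [mean_sum_X_pow, Finset.sum_eq_zero, zero_div]
    intro π _
    rw [lpk_eq_zero π (by simp), Nat.cast_zero]
  induction k with
  | zero =>
    refine (h 0).trans ?_
    rw [h0, c_one hr]
    field_simp
    push_cast
    ring
  | succ k ih =>
    refine (h (k + 1)).trans ?_
    change (1 - _) * mean (Clpk r (k + 1)) + _ = _
    rw [ih, c_succ hr (Nat.succ_pos k)]
    push_cast
    field_simp
    ring

end StirlingClusters

theorem mainTheorem7 (r : ℕ) (hr : 2 ≤ r) :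
    (∀ k : ℕ, 1 ≤ k →
      MeasureTheory.IsProbabilityMeasure (StirlingClusters.law (StirlingClusters.Cdes r k)) ∧
      MeasureTheory.IsProbabilityMeasure (StirlingClusters.law (StirlingClusters.Cpk r k)) ∧
      MeasureTheory.IsProbabilityMeasure (StirlingClusters.law (StirlingClusters.Clpk r k)) ∧
      StirlingClusters.mean (StirlingClusters.Cdes r k) = ((r : ℝ) * k + 1) / (r + 1) ∧
      StirlingClusters.mean (StirlingClusters.Cpk r k) =
        ((2 * (k : ℝ) - 1) * r) / (2 * (r + 2)) - (r : ℝ) / 2 * StirlingClusters.c r k ∧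
      StirlingClusters.mean (StirlingClusters.Clpk r k) =
        ((r : ℝ) * k + 1) / (r + 2) + StirlingClusters.c r k) ∧
    Asymptotics.IsEquivalent Filter.atTop
      (fun k : ℕ => StirlingClusters.mean (StirlingClusters.Cdes r k))
      (fun k : ℕ => (r : ℝ) * k / (r + 1)) ∧
    Asymptotics.IsEquivalent Filter.atTop
      (fun k : ℕ => StirlingClusters.mean (StirlingClusters.Cpk r k))
      (fun k : ℕ => (r : ℝ) * k / (r + 2)) ∧
    Asymptotics.IsEquivalent Filter.atTop
      (fun k : ℕ => StirlingClusters.mean (StirlingClusters.Clpk r k))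
      (fun k : ℕ => (r : ℝ) * k / (r + 2)) ∧
    Asymptotics.IsEquivalent Filter.atTop
      (fun k : ℕ => StirlingClusters.variance (StirlingClusters.Cdes r k))
      (fun k : ℕ => (r : ℝ) ^ 2 * k / ((r + 1) ^ 2 * (r + 2))) ∧
    Asymptotics.IsEquivalent Filter.atTop
      (fun k : ℕ => StirlingClusters.variance (StirlingClusters.Cpk r k))
      (fun k : ℕ => 2 * (r : ℝ) ^ 2 * k / ((r + 2) ^ 2 * (r + 4))) ∧
    Asymptotics.IsEquivalent Filter.atTop
      (fun k : ℕ => StirlingClusters.variance (StirlingClusters.Clpk r k))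
      (fun k : ℕ => 2 * (r : ℝ) ^ 2 * k / ((r + 2) ^ 2 * (r + 4))) := by
  have hr0 : 0 < r := by omega
  have hr' : (0 : ℝ) < r := by exact_mod_cast hr0
  have h0 := StirlingClusters.P_zero_nonempty r
  have hd := StirlingClusters.growsByInsertion_des hr
  have hp := StirlingClusters.growsByInsertion_pk hr
  have hl := StirlingClusters.growsByInsertion_lpk hr
  refine ⟨fun k hk => ?_, ?_, ?_, ?_, ?_, ?_, ?_⟩
  · obtain ⟨k, rfl⟩ := Nat.exists_eq_add_of_le' hk
    have hne := hd.nonempty h0 (k + 1)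
    exact ⟨StirlingClusters.isProbabilityMeasure_law _ _ hne,
      StirlingClusters.isProbabilityMeasure_law _ _ hne,
      StirlingClusters.isProbabilityMeasure_law _ _ hne,
      StirlingClusters.mean_Cdes_succ hr k, StirlingClusters.mean_Cpk_succ hr k,
      StirlingClusters.mean_Clpk_succ hr k⟩
  · exact StirlingClusters.isEquivalent_of_tendsto_div (by positivity)
      (hd.tendsto_mean_div h0 hr0 zero_le_one) fun k => by ring
  · exact StirlingClusters.isEquivalent_of_tendsto_div (by positivity)
      (hp.tendsto_mean_div h0 hr0 zero_le_two) fun k => by ring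
  · exact StirlingClusters.isEquivalent_of_tendsto_div (by positivity)
      (hl.tendsto_mean_div h0 hr0 zero_le_two) fun k => by ring
  · exact StirlingClusters.isEquivalent_of_tendsto_div (by positivity)
      (hd.tendsto_variance_div h0 hr0 zero_le_one) fun k => by ring
  · exact StirlingClusters.isEquivalent_of_tendsto_div (by positivity)
      (hp.tendsto_variance_div h0 hr0 zero_le_two) fun k => by ring
  · exact StirlingClusters.isEquivalent_of_tendsto_div (by positivity)
      (hl.tendsto_variance_div h0 hr0 zero_le_two) fun k => by ring
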